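/- A group is called \emph{large} if some subgroup of finite index in it admits a surjective homomorphism onto a non-cyclic free group. For a subset $S$ of a group $G$, let $\langle\langle S\rangle\rangle^G$ denote the normal closure of $S$ in $G$. Theorem. Let $G$ be a group (not necessarily finitely generated), let $H$ be a normal subgroup of finite index in $G$ that admits a surjective homomorphism onto a non-cyclic free group (so that $G$ is large), and let $g_1,\ldots,g_k$ be elements of $H$. Then the quotient group $G/\langle\langle g_1^n,\ldots,g_k^n\rangle\rangle^G$ is large for all but finitely many $n\in\mathbb{N}$. -/

import Mathlib

universe u

/-- The group `H` admits a surjective homomorphism onto some non-cyclic free group.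
(A surjective image of `H` has a copy in the universe of `H`, so letting `F` range over
that universe loses nothing.) -/
def MapsOntoNoncyclicFree (H : Type u) [Group H] : Prop :=
  ∃ (F : Type u) (_ : Group F),
    IsFreeGroup F ∧ ¬ IsCyclic F ∧ ∃ φ : H →* F, Function.Surjective φ

/-- A group is large if some subgroup of finite index admits a surjective homomorphism
onto a non-cyclic free group. -/
def IsLargeGroup (G : Type u) [Group G] : Prop :=
  ∃ K : Subgroup G, K.FiniteIndex ∧ MapsOntoNoncyclicFree K

/-!
A non-cyclic free group maps onto the free group `F` of rank two, and the normal closure in `G` of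
`g₁ ^ n, …, gₖ ^ n` is the normal closure in `H` of finitely many `n`-th powers, one for each `gᵢ`
and each coset of `H`. So it suffices to show that for nontrivial `f₁, …, fₘ` in `F` and large `n`
the quotient of `F` by the `fᵢ ^ n` is large
(`FreeGroup.exists_largeModulo_normalClosure_pow_of_ne_one`). Largeness of quotients is transported
in the form `LargeModulo`.

*Choice of a finite quotient.* A nontrivial element of a free group has a nontrivial image in a
group of unitriangular matrices over `ℤ`: the product of syllables `x_{i₁}^{e₁} ⋯ x_{iₛ}^{eₛ}` acts
with top right entry `e₁ ⋯ eₛ` when each generator is sent to `1 + E` for a suitable `E` of square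
zero. Unitriangular `d × d` matrices over `ℤ/q` have exponent dividing `n` as soon as `q` divides
`n.choose 1, …, n.choose (d - 1)`, and `q = n / gcd(n, d!)` does so and is large when `n` is. Hence
the element survives in a finite quotient of exponent dividing `n`, for all large `n`
(`FreeGroup.exists_finiteIndex_pow_mem`). Applied to the powers `fᵢ ^ s` with `1 ≤ s ≤ m` this gives
a normal subgroup `K` of finite index that contains all `n`-th powers and modulo which each `fᵢ` has
order greater than `m`.

*Counting relators.* Since `fᵢ` commutes with `fᵢ ^ n`, the latter has, up to conjugacy in `K`, at
most `[F : K] / (m + 1)` conjugates in `F`. So the quotient of `K` is defined by fewer than `[F : K]`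
relators, whereas `K` is free on at least `[F : K] + 1` generators
(`FreeGroupBasis.card_mul_index_add_one_le`).

*Deficiency at least two.* A group with at least two more generators than relators is large, by a
theorem of Baumslag and Pride (`largeModulo_normalClosure_range_of_card_add_two_le`). The proof here
exhibits a homomorphism to the wreath product of a free group by `ℤ/N`: requiring it to kill the
relators becomes a homogeneous linear system over `ℤ` with more unknowns than equations, provided
that the unknowns are placed far enough from the two ends of `[0, N)` that cyclic translation never
wraps around.
-/

/-! ### Unitriangular representations of free groups -/

/-- `StrictUpper s N`: all entries of `N` below the `s`-th superdiagonal vanish. For `s = 1` this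
says that `N` is strictly upper triangular. -/
def StrictUpper {R : Type*} [Zero R] {d : ℕ} (s : ℕ) (N : Matrix (Fin d) (Fin d) R) : Prop :=
  ∀ i j : Fin d, (j : ℕ) < i + s → N i j = 0

namespace StrictUpper

variable {R : Type*} [Ring R] {d : ℕ}

theorem add {s : ℕ} {M N : Matrix (Fin d) (Fin d) R} (hM : StrictUpper s M)
    (hN : StrictUpper s N) : StrictUpper s (M + N) := fun i j h => by
  rw [Matrix.add_apply, hM i j h, hN i j h, add_zero]

theorem mul {s t : ℕ} {M N : Matrix (Fin d) (Fin d) R} (hM : StrictUpper s M)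
    (hN : StrictUpper t N) : StrictUpper (s + t) (M * N) := fun i j h => by
  rw [Matrix.mul_apply]
  refine Finset.sum_eq_zero fun k _ => ?_
  by_cases hk : (k : ℕ) < i + s
  · rw [hM i k hk, zero_mul]
  · rw [hN k j (by omega), mul_zero]

theorem mono {s t : ℕ} (h : t ≤ s) {M : Matrix (Fin d) (Fin d) R} (hM : StrictUpper s M) :
    StrictUpper t M := fun i j hij => hM i j (by omega)

theorem pow {M : Matrix (Fin d) (Fin d) R} (hM : StrictUpper 1 M) (s : ℕ) :
    StrictUpper s (M ^ s) := by
  induction s with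
  | zero =>
    intro i j h
    rw [pow_zero, Matrix.one_apply_ne]
    rintro rfl
    omega
  | succ s ih =>
    rw [pow_succ]
    exact ih.mul hM

theorem pow_eq_zero {M : Matrix (Fin d) (Fin d) R} (hM : StrictUpper 1 M) {s : ℕ} (hs : d ≤ s) :
    M ^ s = 0 := by
  ext i j
  exact hM.pow s i j (by omega)

/-- If `m` divides the binomial coefficients `n.choose k` for `0 < k < d`, then the unitriangular
`d × d` matrices over `ℤ/m` have exponent dividing `n`. -/
theorem one_add_pow_eq_one {m n : ℕ} {M : Matrix (Fin d) (Fin d) (ZMod m)}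
    (hM : StrictUpper 1 M) (hn : ∀ k, 0 < k → k < d → m ∣ n.choose k) : (1 + M) ^ n = 1 := by
  rw [add_comm, (Commute.one_right M).add_pow, Finset.sum_eq_single 0]
  · simp
  · intro k _ hk
    by_cases hkd : k < d
    · obtain ⟨c, hc⟩ := hn k (Nat.pos_of_ne_zero hk) hkd
      have hm : ((m : ℕ) : Matrix (Fin d) (Fin d) (ZMod m)) = 0 := by
        rw [← map_natCast (Matrix.scalar (Fin d)), ZMod.natCast_self, map_zero]
      rw [hc, Nat.cast_mul, hm, zero_mul, mul_zero]
    · rw [hM.pow_eq_zero (by omega), zero_mul, zero_mul]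
  · simp

end StrictUpper

/-- Since `k * n.choose k = n * (n - 1).choose (k - 1)`, the binomial coefficient is divisible by
`n` up to a factor of `k`. -/
theorem div_gcd_factorial_dvd_choose {n d k : ℕ} (hn : 0 < n) (hk : 0 < k) (hkd : k ≤ d) :
    n / n.gcd d.factorial ∣ n.choose k := by
  obtain ⟨n, rfl⟩ : ∃ n', n = n' + 1 := ⟨n - 1, by omega⟩
  obtain ⟨k, rfl⟩ : ∃ k', k = k' + 1 := ⟨k - 1, by omega⟩
  have h1 : (n + 1) ∣ d.factorial * (n + 1).choose (k + 1) := by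
    have h2 : (n + 1) ∣ (k + 1) * (n + 1).choose (k + 1) :=
      ⟨n.choose k, by rw [Nat.add_one_mul_choose_eq]; ring⟩
    exact h2.trans (Nat.mul_dvd_mul_right (Nat.dvd_factorial (by omega) hkd) _)
  have hg : 0 < (n + 1).gcd d.factorial := Nat.gcd_pos_of_pos_left _ hn
  refine (Nat.coprime_div_gcd_div_gcd hg).dvd_of_dvd_mul_left ?_
  refine Nat.dvd_of_mul_dvd_mul_left hg ?_
  rwa [Nat.mul_div_cancel' (Nat.gcd_dvd_left _ _), ← mul_assoc,
    Nat.mul_div_cancel' (Nat.gcd_dvd_right _ _)]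

/-- The unit `1 + E` attached to an element of square zero. -/
def oneAddUnit {A : Type*} [Ring A] (E : A) (hE : E * E = 0) : Aˣ where
  val := 1 + E
  inv := 1 - E
  val_inv := by rw [mul_sub, add_mul _ _ E, hE]; simp
  inv_val := by rw [mul_add, sub_mul _ _ E, hE]; simp

theorem oneAddUnit_zpow {A : Type*} [Ring A] (E : A) (hE : E * E = 0) (z : ℤ) :
    ((oneAddUnit E hE ^ z : Aˣ) : A) = 1 + z • E := by
  induction z using Int.induction_on with
  | zero => simp
  | succ n ih =>
    rw [zpow_add_one, Units.val_mul, ih]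
    change (1 + (n : ℤ) • E) * (1 + E) = _
    rw [mul_add, add_mul _ _ E, smul_mul_assoc, hE, add_smul]
    simp [add_assoc]
  | pred n ih =>
    rw [zpow_sub_one, Units.val_mul, ih]
    change (1 + (-n : ℤ) • E) * (1 - E) = _
    rw [mul_sub, add_mul _ _ E, smul_mul_assoc, hE, sub_smul]
    simp [sub_eq_add_neg, add_assoc]

/-- The matrix with entry `1` at the positions `(a, a + 1)` with `idx a = i`, and `0` elsewhere. -/
def stepMatrix {ι : Type*} [DecidableEq ι] (R : Type*) [Ring R] (k : ℕ) (idx : ℕ → ι) (i : ι) :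
    Matrix (Fin (k + 1)) (Fin (k + 1)) R :=
  Matrix.of fun a b => if (b : ℕ) = a + 1 ∧ idx a = i then 1 else 0

theorem stepMatrix_mul_self {ι : Type*} [DecidableEq ι] (R : Type*) [Ring R] {k : ℕ} {idx : ℕ → ι}
    (hidx : ∀ a, a + 1 < k → idx a ≠ idx (a + 1)) (i : ι) :
    stepMatrix R k idx i * stepMatrix R k idx i = 0 := by
  ext a b
  rw [Matrix.mul_apply]
  refine Finset.sum_eq_zero fun c _ => ?_
  simp only [stepMatrix, Matrix.of_apply, mul_ite, mul_one, mul_zero]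
  split_ifs with h1 h2
  · exfalso
    refine hidx a (by have := b.2; omega) ?_
    rw [h2.2, ← h1.2, h2.1]
  · rfl
  · rfl

theorem strictUpper_stepMatrix {ι : Type*} [DecidableEq ι] (R : Type*) [Ring R] (k : ℕ)
    (idx : ℕ → ι) (i : ι) : StrictUpper 1 (stepMatrix R k idx i) := by
  intro a b h
  simp only [stepMatrix, Matrix.of_apply]
  rw [if_neg (by omega)]

/-- The representation of the free group sending the `i`-th generator to `1 + E i`, where `E i` is
the `i`-th step matrix. -/
def stepRep {ι : Type*} [DecidableEq ι] (R : Type*) [Ring R] {k : ℕ} {idx : ℕ → ι}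
    (hidx : ∀ a, a + 1 < k → idx a ≠ idx (a + 1)) :
    FreeGroup ι →* (Matrix (Fin (k + 1)) (Fin (k + 1)) R)ˣ :=
  FreeGroup.lift fun i => oneAddUnit (stepMatrix R k idx i) (stepMatrix_mul_self R hidx i)

theorem strictUpper_stepRep_sub_one {ι : Type*} [DecidableEq ι] (R : Type*) [Ring R] {k : ℕ}
    {idx : ℕ → ι} (hidx : ∀ a, a + 1 < k → idx a ≠ idx (a + 1)) (x : FreeGroup ι) :
    StrictUpper 1 ((stepRep R hidx x : Matrix (Fin (k + 1)) (Fin (k + 1)) R) - 1) := by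
  induction x using FreeGroup.induction_on with
  | C1 => intro i j _; simp
  | of i =>
    simp only [stepRep, FreeGroup.lift_apply_of]
    have : (oneAddUnit _ (stepMatrix_mul_self R hidx i) :
        Matrix (Fin (k + 1)) (Fin (k + 1)) R) - 1 = stepMatrix R k idx i :=
      add_sub_cancel_left _ _
    rw [this]
    exact strictUpper_stepMatrix R k idx i
  | inv_of i _ =>
    simp only [stepRep, map_inv, FreeGroup.lift_apply_of]
    have : ((oneAddUnit _ (stepMatrix_mul_self R hidx i))⁻¹ :
        (Matrix (Fin (k + 1)) (Fin (k + 1)) R)ˣ) - (1 : Matrix (Fin (k + 1)) (Fin (k + 1)) R)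
        = - stepMatrix R k idx i := by
      change (1 - _) - 1 = _
      abel
    rw [this]
    intro a b h
    rw [Matrix.neg_apply, strictUpper_stepMatrix R k idx i a b h, neg_zero]
  | mul x y hx hy =>
    rw [map_mul, Units.val_mul]
    generalize (stepRep R hidx x : Matrix (Fin (k + 1)) (Fin (k + 1)) R) = X at *
    generalize (stepRep R hidx y : Matrix (Fin (k + 1)) (Fin (k + 1)) R) = Y at *
    have : X * Y - 1 = (X - 1) * (Y - 1) + ((X - 1) + (Y - 1)) := by noncomm_ring
    rw [this]
    exact ((hx.mul hy).mono (by omega)).add (hx.add hy)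

/-- Every element of a free group is a product of powers of generators with nonzero exponents,
adjacent generators being distinct. -/
theorem FreeGroup.exists_syllables {ι : Type*} (x : FreeGroup ι) :
    ∃ l : List (ι × ℤ), (∀ p ∈ l, p.2 ≠ 0) ∧ l.IsChain (fun p q => p.1 ≠ q.1) ∧
      x = (l.map fun p => FreeGroup.of p.1 ^ p.2).prod := by
  classical
  let w := Monoid.CoprodI.Word.equiv (freeGroupEquivCoprodI x)
  have hw : w.prod = freeGroupEquivCoprodI x :=
    Monoid.CoprodI.Word.equiv.symm_apply_apply (freeGroupEquivCoprodI x)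
  refine ⟨w.toList.map fun s => (s.1, FreeGroup.freeGroupUnitEquivInt s.2), ?_, ?_, ?_⟩
  · intro p hp
    obtain ⟨s, hs, rfl⟩ := List.mem_map.1 hp
    intro h0
    refine w.ne_one s hs ?_
    rw [← FreeGroup.freeGroupUnitEquivInt.symm_apply_apply s.2]
    simp only at h0
    rw [h0]
    rfl
  · rw [List.isChain_map]
    exact w.chain_ne
  · apply freeGroupEquivCoprodI.injective
    rw [← hw, Monoid.CoprodI.Word.prod, map_list_prod, List.map_map, List.map_map]
    congr 1
    refine List.map_congr_left fun s _ => ?_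
    have h2 : s.2 = FreeGroup.of () ^ (FreeGroup.freeGroupUnitEquivInt s.2) :=
      (FreeGroup.freeGroupUnitEquivInt.symm_apply_apply s.2).symm
    simp only [Function.comp]
    conv_lhs => rw [h2]
    rw [map_zpow, map_zpow]
    simp

/-- The top row of the matrix of a product of `s` syllables reaches exactly the column `s`: each
syllable moves at most one step to the right, and moves one step with its exponent as weight. -/
theorem stepRep_take {ι : Type*} [DecidableEq ι] (R : Type*) [Ring R] (l : List (ι × ℤ))
    {idx : ℕ → ι} (hl : ∀ a (h : a < l.length), idx a = l[a].1)
    (hidx : ∀ a, a + 1 < l.length → idx a ≠ idx (a + 1)) (s : ℕ) (hs : s ≤ l.length) :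
    let P : Matrix (Fin (l.length + 1)) (Fin (l.length + 1)) R :=
      stepRep R hidx ((l.take s).map fun p => FreeGroup.of p.1 ^ p.2).prod
    (∀ b : Fin (l.length + 1), s < b → P 0 b = 0) ∧
      P 0 ⟨s, by omega⟩ = (((l.take s).map Prod.snd).prod : ℤ) := by
  induction s with
  | zero =>
    refine ⟨fun b hb => ?_, ?_⟩
    · simp only [List.take_zero, List.map_nil, List.prod_nil, map_one, Units.val_one]
      rw [Matrix.one_apply_ne]
      rintro rfl
      simp at hb
    · simp
  | succ s ih =>
    obtain ⟨h1, h2⟩ := ih (by omega)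
    have hs' : s < l.length := by omega
    have hidxs := hl s hs'
    rw [← List.take_append_getElem hs']
    simp only [List.map_append, List.prod_append, map_mul, Units.val_mul, List.map_cons,
      List.map_nil, List.prod_cons, List.prod_nil, mul_one, map_zpow]
    have hE : ((stepRep R hidx (FreeGroup.of l[s].1) ^ l[s].2 :
        (Matrix (Fin (l.length + 1)) (Fin (l.length + 1)) R)ˣ) :
        Matrix (Fin (l.length + 1)) (Fin (l.length + 1)) R)
        = 1 + l[s].2 • stepMatrix R l.length idx l[s].1 := by
      simp only [stepRep, FreeGroup.lift_apply_of]
      exact oneAddUnit_zpow _ _ _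
    rw [hE]
    generalize (stepRep R hidx ((l.take s).map fun p => FreeGroup.of p.1 ^ p.2).prod :
      Matrix (Fin (l.length + 1)) (Fin (l.length + 1)) R) = P at *
    have key : ∀ b : Fin (l.length + 1), ∀ hb : s + 1 ≤ b,
        (P * (1 + l[s].2 • stepMatrix R l.length idx l[s].1)) 0 b
          = P 0 ⟨s, by omega⟩ * (if (b : ℕ) = s + 1 then (l[s].2 : R) else 0) := by
      intro b hb
      rw [mul_add, mul_one, Matrix.add_apply, h1 b (by omega), zero_add, Matrix.mul_apply,
        Finset.sum_eq_single ⟨s, by omega⟩]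
      · simp only [Matrix.smul_apply, stepMatrix, Matrix.of_apply, hidxs, and_true]
        split_ifs <;> simp
      · intro c _ hc
        simp only [Matrix.smul_apply, stepMatrix, Matrix.of_apply]
        rcases lt_trichotomy (c : ℕ) s with h | h | h
        · rw [if_neg (by omega)]; simp
        · exact absurd (Fin.ext h) hc
        · rw [h1 c h, zero_mul]
      · simp
    refine ⟨fun b hb => ?_, ?_⟩
    · rw [key b (by omega), if_neg (by omega), mul_zero]
    · rw [key _ le_rfl, if_pos rfl, h2]
      simp

/-- A nontrivial element of a free group survives, for all large `n`, in some finite quotient of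
exponent dividing `n`. -/
theorem FreeGroup.exists_finiteIndex_pow_mem {ι : Type*} (x : FreeGroup ι) (hx : x ≠ 1) :
    ∃ n₀ : ℕ, ∀ n > n₀, ∃ K : Subgroup (FreeGroup ι), K.Normal ∧ K.FiniteIndex ∧
      (∀ y, y ^ n ∈ K) ∧ x ∉ K := by
  classical
  obtain ⟨l, hl0, hl1, rfl⟩ := x.exists_syllables
  have hlen : 0 < l.length := by
    rw [List.length_pos_iff]
    rintro rfl
    simp at hx
  obtain ⟨idx, hidx⟩ : ∃ idx : ℕ → ι, ∀ a (h : a < l.length), idx a = l[a].1 :=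
    ⟨fun a => if h : a < l.length then l[a].1 else l[0].1, fun a h => by simp [h]⟩
  have hne : ∀ a, a + 1 < l.length → idx a ≠ idx (a + 1) := by
    intro a ha
    rw [hidx a (by omega), hidx (a + 1) ha]
    exact List.isChain_iff_getElem.1 hl1 a ha
  set e : ℤ := (l.map Prod.snd).prod with he
  have he0 : e ≠ 0 := by
    rw [he, Ne, List.prod_eq_zero_iff]
    intro h
    obtain ⟨p, hp, hp0⟩ := List.mem_map.1 h
    exact hl0 p hp hp0
  set D := (l.length + 1).factorial with hD
  refine ⟨D * e.natAbs, fun n hn => ?_⟩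
  have hn0 : 0 < n := by omega
  -- The modulus divides the relevant binomial coefficients, and exceeds `|e|`.
  set m := n / n.gcd D with hm
  have hg : 0 < n.gcd D := Nat.gcd_pos_of_pos_left _ hn0
  have hme : e.natAbs < m := by
    have h1 : n = n.gcd D * m := (Nat.mul_div_cancel' (Nat.gcd_dvd_left _ _)).symm
    have h2 : n.gcd D ≤ D := Nat.gcd_le_right _ (Nat.factorial_pos _)
    by_contra! h
    have := Nat.mul_le_mul h2 h
    omega
  have : NeZero m := ⟨by omega⟩
  refine ⟨(stepRep (ZMod m) hne).ker, inferInstance, Subgroup.finiteIndex_ker _, fun y => ?_, ?_⟩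
  · rw [MonoidHom.mem_ker, map_pow, Units.ext_iff, Units.val_pow_eq_pow_val, Units.val_one]
    have := (strictUpper_stepRep_sub_one (ZMod m) hne y).one_add_pow_eq_one (n := n)
      fun k hk hkd => div_gcd_factorial_dvd_choose hn0 hk hkd.le
    rwa [add_sub_cancel] at this
  · intro hmem
    have h := (stepRep_take (ZMod m) l hidx hne l.length le_rfl).2
    simp only [List.take_length] at h
    rw [MonoidHom.mem_ker.1 hmem, Units.val_one, Matrix.one_apply_ne, ← he] at h
    · rw [eq_comm, ZMod.intCast_zmod_eq_zero_iff_dvd] at h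
      have := Nat.le_of_dvd (by omega) (Int.natCast_dvd.1 h)
      omega
    · intro h0
      have := congrArg Fin.val h0
      simp at this
      omega

/-! ### Largeness modulo a subgroup -/

/-- `LargeModulo N`: some subgroup of finite index of `G` containing `N` has a homomorphism to a
free group that kills `N` and has non-commuting values. When `N` is normal this makes `G ⧸ N` large,
since the image of the homomorphism is again free. -/
def LargeModulo {G : Type*} [Group G] (N : Subgroup G) : Prop :=
  ∃ L : Subgroup G, L.FiniteIndex ∧ ∃ ψ : L →* FreeGroup Bool,
    (∃ a b, ¬ Commute (ψ a) (ψ b)) ∧ ∀ x ∈ N, ∃ h : x ∈ L, ψ ⟨x, h⟩ = 1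

theorem LargeModulo.isLargeGroup {G : Type u} [Group G] {N : Subgroup G} [N.Normal]
    (h : LargeModulo N) : IsLargeGroup (G ⧸ N) := by
  obtain ⟨L, hL, ψ, ⟨a, b, hab⟩, hN⟩ := h
  have hs := QuotientGroup.mk'_surjective N
  refine ⟨L.map (QuotientGroup.mk' N), ?_, L ⧸ ψ.ker, inferInstance, ?_, ?_, ?_⟩
  · exact ⟨fun h0 => hL.index_ne_zero (Nat.eq_zero_of_zero_dvd (h0 ▸ L.index_map_dvd hs))⟩
  · exact IsFreeGroup.ofMulEquiv (QuotientGroup.quotientKerEquivRange ψ).symm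
  · intro hc
    refine hab ?_
    have h1 := (IsCyclic.isMulCommutative (α := L ⧸ ψ.ker)).is_comm.comm (a : L ⧸ ψ.ker) b
    have h2 := congrArg (QuotientGroup.kerLift ψ) h1
    simpa [Commute, SemiconjBy] using h2
  · have hπ := MonoidHom.subgroupMap_surjective (QuotientGroup.mk' N) L
    have hker : ((QuotientGroup.mk' N).subgroupMap L).ker ≤ (QuotientGroup.mk' ψ.ker).ker := by
      intro x hx
      rw [QuotientGroup.ker_mk', MonoidHom.mem_ker]
      have hxN : (x : G) ∈ N := by
        have := congrArg Subtype.val (MonoidHom.mem_ker.1 hx)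
        exact (QuotientGroup.eq_one_iff _).1 this
      exact (hN x hxN).2
    refine ⟨((QuotientGroup.mk' N).subgroupMap L).liftOfSurjective hπ
      ⟨QuotientGroup.mk' ψ.ker, hker⟩, fun y => ?_⟩
    obtain ⟨x, rfl⟩ := QuotientGroup.mk'_surjective ψ.ker y
    exact ⟨_, MonoidHom.liftOfRightInverse_comp_apply _ _ _ _ x⟩

theorem LargeModulo.of_subgroup {G : Type*} [Group G] {H : Subgroup G} [H.FiniteIndex]
    {M : Subgroup H} (h : LargeModulo M) {N : Subgroup G} (hN : N ≤ M.map H.subtype) :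
    LargeModulo N := by
  obtain ⟨L, hL, ψ, ⟨a, b, hab⟩, hM⟩ := h
  let e := L.equivMapOfInjective H.subtype H.subtype_injective
  refine ⟨L.map H.subtype, ⟨?_⟩, ψ.comp e.symm.toMonoidHom, ⟨e a, e b, by simpa using hab⟩, ?_⟩
  · rw [Subgroup.index_map_subtype]
    exact mul_ne_zero hL.index_ne_zero Subgroup.FiniteIndex.index_ne_zero
  · intro x hx
    obtain ⟨y, hy, rfl⟩ := hN hx
    obtain ⟨hyL, h1⟩ := hM y hy
    refine ⟨⟨y, hyL, rfl⟩, ?_⟩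
    have : e.symm ⟨H.subtype y, ⟨y, hyL, rfl⟩⟩ = ⟨y, hyL⟩ := by
      rw [MulEquiv.symm_apply_eq]
      rfl
    change ψ (e.symm _) = 1
    rw [this, h1]

theorem LargeModulo.comap {G F : Type*} [Group G] [Group F] {φ : G →* F}
    (hφ : Function.Surjective φ) {M : Subgroup F} (h : LargeModulo M) {N : Subgroup G}
    (hN : N ≤ M.comap φ) : LargeModulo N := by
  obtain ⟨L, hL, ψ, ⟨⟨a, ha⟩, ⟨b, hb⟩, hab⟩, hM⟩ := h
  obtain ⟨a, rfl⟩ := hφ a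
  obtain ⟨b, rfl⟩ := hφ b
  refine ⟨L.comap φ, ⟨?_⟩, ψ.comp (φ.subgroupComap L), ⟨⟨a, ha⟩, ⟨b, hb⟩, hab⟩, fun x hx => ?_⟩
  · rw [Subgroup.index_comap_of_surjective L hφ]
    exact hL.index_ne_zero
  · obtain ⟨h1, h2⟩ := hM _ (hN hx)
    exact ⟨h1, h2⟩

/-- A non-cyclic free group retracts onto a free group of rank two. -/
theorem IsFreeGroup.exists_surjective_freeGroup_bool (F : Type*) [Group F] [IsFreeGroup F]
    (hF : ¬ IsCyclic F) : ∃ φ : F →* FreeGroup Bool, Function.Surjective φ := by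
  classical
  have : Nontrivial (IsFreeGroup.Generators F) := by
    by_contra hX
    rw [not_nontrivial_iff_subsingleton] at hX
    refine hF ?_
    have : IsCyclic (FreeGroup (IsFreeGroup.Generators F)) := by
      rcases isEmpty_or_nonempty (IsFreeGroup.Generators F) with hE | ⟨⟨x⟩⟩
      · infer_instance
      · refine ⟨FreeGroup.of x, fun y => ?_⟩
        change y ∈ Subgroup.zpowers (FreeGroup.of x)
        induction y using FreeGroup.induction_on with
        | C1 => exact one_mem _
        | of z => rw [Subsingleton.elim z x]; exact Subgroup.mem_zpowers _
        | inv_of z h => exact inv_mem h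
        | mul y z hy hz => exact mul_mem hy hz
    exact isCyclic_of_surjective (IsFreeGroup.mulEquiv F) (IsFreeGroup.mulEquiv F).surjective
  obtain ⟨x, y, hxy⟩ := exists_pair_ne (IsFreeGroup.Generators F)
  let r : FreeGroup (IsFreeGroup.Generators F) →* FreeGroup Bool :=
    FreeGroup.lift fun z => if z = x then FreeGroup.of true else FreeGroup.of false
  let i : FreeGroup Bool →* FreeGroup (IsFreeGroup.Generators F) :=
    FreeGroup.lift fun c => if c then FreeGroup.of x else FreeGroup.of y
  have hri : r.comp i = MonoidHom.id _ := by
    ext c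
    cases c <;> simp [r, i, hxy.symm]
  refine ⟨r.comp (IsFreeGroup.toFreeGroup F).toMonoidHom, fun w => ?_⟩
  exact ⟨(IsFreeGroup.toFreeGroup F).symm (i w), by simpa using DFunLike.congr_fun hri w⟩

theorem FreeGroup.not_commute_pow_zpow {n : ℕ} (hn : n ≠ 0) {c : ℤ} (hc : c ≠ 0) :
    ¬ Commute (FreeGroup.of true ^ n) (FreeGroup.of false ^ c) := by
  intro h
  -- Roots are unique in free groups, so a power commutes with nothing more than its root does.
  have aux : ∀ {x y : FreeGroup Bool} {k : ℤ}, k ≠ 0 → Commute (x ^ k) y → Commute x y := by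
    intro x y k hk hxy
    have h1 : (y * x * y⁻¹) ^ k = x ^ k := by
      rw [conj_zpow, hxy.eq.symm, mul_inv_cancel_right]
    have h2 := zpow_left_injective hk h1
    exact (mul_inv_eq_iff_eq_mul.1 h2).symm
  have h1 : Commute (FreeGroup.of true) (FreeGroup.of false ^ c) :=
    aux (k := n) (by exact_mod_cast hn) (by simpa using h)
  have h2 : Commute (FreeGroup.of false) (FreeGroup.of true) := aux hc h1.symm
  exact absurd h2.eq (by decide)

/-! ### Free groups modulo few relators -/

theorem LinearMap.exists_ne_zero_apply_eq_zero_of_card_lt {ι κ : Type*} [Fintype ι] [Fintype κ]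
    (h : Fintype.card κ < Fintype.card ι) (f : (ι → ℤ) →ₗ[ℤ] (κ → ℤ)) :
    ∃ u, u ≠ 0 ∧ f u = 0 := by
  by_contra! hf
  have hinj : Function.Injective f :=
    (injective_iff_map_eq_zero f).2 fun u hu => by_contra fun h0 => hf u h0 hu
  have := LinearMap.finrank_le_finrank_of_injective hinj
  simp only [Module.finrank_fintype_fun_eq_card] at this
  omega

/-- Fewer relators than generators leave an epimorphism onto `ℤ`. -/
theorem FreeGroup.exists_hom_int {Y ρ : Type*} [Fintype Y] [Fintype ρ] (r : ρ → FreeGroup Y)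
    (h : Fintype.card ρ < Fintype.card Y) :
    ∃ τ : FreeGroup Y →* Multiplicative ℤ, (∀ l, τ (r l) = 1) ∧ Function.Surjective τ := by
  -- The exponent sum of a word is linear in the values chosen for the generators.
  let θ : FreeGroup Y →* Multiplicative ((Y → ℤ) →ₗ[ℤ] ℤ) :=
    FreeGroup.lift fun y => Multiplicative.ofAdd (LinearMap.proj y)
  obtain ⟨u, hu, hur⟩ := LinearMap.exists_ne_zero_apply_eq_zero_of_card_lt h
    (LinearMap.pi fun l => Multiplicative.toAdd (θ (r l)))
  let ev : ((Y → ℤ) →ₗ[ℤ] ℤ) →+ ℤ := (LinearMap.applyₗ u).toAddMonoidHom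
  let τ : FreeGroup Y →* Multiplicative ℤ := ev.toMultiplicative.comp θ
  have hτr : ∀ l, τ (r l) = 1 := fun l => congrFun hur l
  obtain ⟨y, hy⟩ := Function.ne_iff.1 hu
  have hτy : τ (FreeGroup.of y) ≠ 1 := by
    intro h1
    refine hy ?_
    have : τ (FreeGroup.of y) = Multiplicative.ofAdd (u y) := by simp [τ, θ, ev]
    rw [this] at h1
    exact h1
  -- The image of `τ` is infinite cyclic.
  obtain ⟨g, hg⟩ := IsCyclic.exists_zpow_surjective (G := τ.range)
  have hg' : Subgroup.zpowers g = ⊤ := by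
    rw [eq_top_iff]
    exact fun x _ => hg x
  have : Infinite τ.range := by
    refine Infinite.of_injective
      (fun k : ℤ => (⟨τ (FreeGroup.of y), _, rfl⟩ : τ.range) ^ k) fun k k' hk => ?_
    have h1 : τ (FreeGroup.of y) ^ k = τ (FreeGroup.of y) ^ k' := congrArg Subtype.val hk
    have h2 := congrArg Multiplicative.toAdd h1
    simp only [toAdd_zpow, smul_eq_mul] at h2
    exact mul_right_cancel₀ (fun h0 => hτy h0) h2
  refine ⟨(intEquivOfZPowersEqTop g hg').symm.toMonoidHom.comp τ.rangeRestrict, fun l => ?_, ?_⟩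
  · have : τ.rangeRestrict (r l) = 1 := Subtype.ext (hτr l)
    simp [this]
  · exact (intEquivOfZPowersEqTop g hg').symm.surjective.comp τ.rangeRestrict_surjective

section Window

variable {Y : Type*} (τ : FreeGroup Y →* Multiplicative ℤ)

/-- The universal crossed homomorphism on a free group into integer sequences `ℤ → ℤ`, on which the
free group acts by translation through `τ`, subject to the generators having values supported in
`[lo, hi)`. Those values are the unknowns `u : Y × [lo, hi) → ℤ`, and the terms of a sequence are
linear forms in `u`; the crossed homomorphism is encoded as a homomorphism to a wreath product whose
right component is `τ`. -/
noncomputable def windowCocycle (lo hi : ℤ) : FreeGroup Y →*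
    Multiplicative ((Y × Finset.Ico lo hi → ℤ) →ₗ[ℤ] ℤ) ≀ᵣ Multiplicative ℤ :=
  FreeGroup.lift fun y =>
    ⟨fun j => if h : Multiplicative.toAdd j ∈ Finset.Ico lo hi then
      Multiplicative.ofAdd (LinearMap.proj (y, ⟨Multiplicative.toAdd j, h⟩)) else 1,
      τ (FreeGroup.of y)⟩

/-- The `j`-th term, as a linear form in the unknowns, of the crossed homomorphism
`windowCocycle τ lo hi` at `w`. -/
noncomputable def windowCoeff (lo hi : ℤ) (w : FreeGroup Y) (j : ℤ) :
    (Y × Finset.Ico lo hi → ℤ) →ₗ[ℤ] ℤ :=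
  Multiplicative.toAdd ((windowCocycle τ lo hi w).left (Multiplicative.ofAdd j))

variable {τ} {lo hi : ℤ}

theorem windowCocycle_right (w : FreeGroup Y) : (windowCocycle τ lo hi w).right = τ w := by
  have : RegularWreathProduct.rightHom.comp (windowCocycle τ lo hi) = τ := by
    ext y
    simp [windowCocycle]
  exact DFunLike.congr_fun this w

theorem windowCoeff_one (j : ℤ) : windowCoeff τ lo hi 1 j = 0 := by
  simp [windowCoeff]

theorem windowCoeff_of (y : Y) (j : ℤ) (u : Y × Finset.Ico lo hi → ℤ) :
    windowCoeff τ lo hi (FreeGroup.of y) j u =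
      if h : j ∈ Finset.Ico lo hi then u (y, ⟨j, h⟩) else 0 := by
  simp only [windowCoeff, windowCocycle, FreeGroup.lift_apply_of, toAdd_ofAdd]
  split_ifs <;> rfl

theorem windowCoeff_mul (v w : FreeGroup Y) (j : ℤ) :
    windowCoeff τ lo hi (v * w) j =
      windowCoeff τ lo hi v j + windowCoeff τ lo hi w (j - Multiplicative.toAdd (τ v)) := by
  have h : (τ v)⁻¹ * Multiplicative.ofAdd j =
      Multiplicative.ofAdd (j - Multiplicative.toAdd (τ v)) := by
    rw [sub_eq_neg_add]
    rfl
  simp only [windowCoeff, map_mul, RegularWreathProduct.mul_left, Pi.mul_apply, toAdd_mul,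
    windowCocycle_right, h]

theorem windowCoeff_inv (w : FreeGroup Y) (j : ℤ) :
    windowCoeff τ lo hi w⁻¹ j = - windowCoeff τ lo hi w (j + Multiplicative.toAdd (τ w)) := by
  have h : τ w * Multiplicative.ofAdd j =
      Multiplicative.ofAdd (j + Multiplicative.toAdd (τ w)) := by
    rw [add_comm]
    rfl
  simp only [windowCoeff, map_inv, RegularWreathProduct.inv_left, Pi.inv_apply, toAdd_inv,
    windowCocycle_right, h]

variable (N : ℕ)

/-- A sequence of integers, restricted to `[0, N)`, as an element of the base of the wreath product
of a free group by `ℤ/N`. The term `c j` becomes a power of the second generator at the `j`-th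
coordinate, conjugated by the `j`-th power of the first generator. -/
def windowBase (c : ℤ → ℤ) : FreeGroup Bool ≀ᵣ Multiplicative (ZMod N) :=
  ⟨fun q => FreeGroup.of true ^ ((Multiplicative.toAdd q).val : ℤ) *
    FreeGroup.of false ^ c (Multiplicative.toAdd q).val *
    (FreeGroup.of true ^ ((Multiplicative.toAdd q).val : ℤ))⁻¹, 1⟩

/-- The homomorphism sending the generator of `ℤ` to the generator of `ℤ/N` decorated with the first
free generator in each coordinate. -/
def windowShift : Multiplicative ℤ →* FreeGroup Bool ≀ᵣ Multiplicative (ZMod N) where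
  toFun k := ⟨fun _ => FreeGroup.of true ^ Multiplicative.toAdd k,
    Multiplicative.ofAdd ((Multiplicative.toAdd k : ℤ) : ZMod N)⟩
  map_one' := by ext <;> simp
  map_mul' k l := by ext <;> simp [zpow_add]

variable {N}

theorem windowBase_zero : windowBase N (fun _ => 0) = 1 := by
  ext <;> simp [windowBase]

theorem windowBase_mul (c d : ℤ → ℤ) :
    windowBase N c * windowBase N d = windowBase N (fun j => c j + d j) := by
  ext q
  · simp [windowBase, zpow_add, mul_assoc]
  · simp [windowBase]

theorem windowBase_inv (c : ℤ → ℤ) : (windowBase N c)⁻¹ = windowBase N (fun j => - c j) := by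
  rw [inv_eq_iff_mul_eq_one, windowBase_mul, ← windowBase_zero]
  simp

/-- As long as the support stays inside `[0, N)`, conjugation by `windowShift` translates. -/
theorem windowShift_mul_windowBase [NeZero N] {c : ℤ → ℤ} {k : ℤ}
    (hc : ∀ j, c j ≠ 0 → |k| ≤ j ∧ j < N - |k|) :
    windowShift N (Multiplicative.ofAdd k) * windowBase N c =
      windowBase N (fun j => c (j - k)) * windowShift N (Multiplicative.ofAdd k) := by
  ext1
  · funext q
    obtain ⟨q, rfl⟩ := Multiplicative.ofAdd.surjective q
    have hlt : q.val < N := q.val_lt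
    have hq' : Multiplicative.toAdd ((Multiplicative.ofAdd (k : ZMod N))⁻¹ *
        Multiplicative.ofAdd q) = q - k := by
      rw [toAdd_mul, toAdd_inv, toAdd_ofAdd, toAdd_ofAdd]
      ring
    have hv : ((q - k : ZMod N).val : ℤ) = (q.val - k : ℤ) % N := by
      rw [← ZMod.val_intCast]
      simp
    simp only [windowShift, windowBase, MonoidHom.coe_mk, OneHom.coe_mk,
      RegularWreathProduct.mul_left, Pi.mul_apply, toAdd_ofAdd, hq', hv]
    by_cases h : 0 ≤ (q.val - k : ℤ) ∧ (q.val - k : ℤ) < N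
    · rw [Int.emod_eq_of_lt h.1 h.2]
      group
    · have h1 : c (q.val - k) = 0 := by
        by_contra h0
        have := hc _ h0
        have := abs_nonneg k
        omega
      have h2 : c ((q.val - k : ℤ) % N) = 0 := by
        by_contra h0
        obtain ⟨h3, h4⟩ := hc _ h0
        have hN : (0 : ℤ) < N := by omega
        have := le_abs_self k
        have := neg_abs_le k
        rcases lt_or_ge (q.val - k : ℤ) 0 with hneg | hpos
        · have : (q.val - k : ℤ) % N = q.val - k + N := by
            rw [← Int.add_emod_right, Int.emod_eq_of_lt] <;> omega
          omega
        · have : (q.val - k : ℤ) % N = q.val - k - N := by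
            rw [← Int.sub_emod_right, Int.emod_eq_of_lt] <;> omega
          omega
      rw [h1, h2]
      simp
  · simp [windowShift, windowBase]

/-- `WindowControlled τ u θ m κ w`: the translation by `w` is at most `κ`, the sequence attached to
`w` and `u` is supported at distance at least `m` from both ends of `[0, N)`, and `θ w` is its image
in the wreath product. -/
def WindowControlled (τ : FreeGroup Y →* Multiplicative ℤ) (u : Y × Finset.Ico lo hi → ℤ)
    (θ : FreeGroup Y →* FreeGroup Bool ≀ᵣ Multiplicative (ZMod N)) (m κ : ℤ) (w : FreeGroup Y) :
    Prop :=
  |Multiplicative.toAdd (τ w)| ≤ κ ∧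
  (∀ j, windowCoeff τ lo hi w j u ≠ 0 → m ≤ j ∧ j < N - m) ∧
  θ w = windowBase N (fun j => windowCoeff τ lo hi w j u) * windowShift N (τ w)

variable {u : Y × Finset.Ico lo hi → ℤ}
  {θ : FreeGroup Y →* FreeGroup Bool ≀ᵣ Multiplicative (ZMod N)}

theorem WindowControlled.mul [NeZero N] {m m' κ κ' : ℤ} {v w : FreeGroup Y}
    (hv : WindowControlled τ u θ m κ v) (hw : WindowControlled τ u θ m' κ' w) (h : κ ≤ m')
    {m₀ : ℤ} (h₀ : m₀ ≤ m) (h₀' : m₀ ≤ m' - κ) :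
    WindowControlled τ u θ m₀ (κ + κ') (v * w) := by
  obtain ⟨hv1, hv2, hv3⟩ := hv
  obtain ⟨hw1, hw2, hw3⟩ := hw
  refine ⟨?_, fun j hj => ?_, ?_⟩
  · rw [map_mul, toAdd_mul]
    exact (abs_add_le _ _).trans (add_le_add hv1 hw1)
  · rw [windowCoeff_mul, LinearMap.add_apply] at hj
    by_cases h1 : windowCoeff τ lo hi v j u = 0
    · rw [h1, zero_add] at hj
      have := hw2 _ hj
      have := abs_le.1 hv1
      omega
    · have := hv2 _ h1
      omega
  · have hs := windowShift_mul_windowBase (N := N) (k := Multiplicative.toAdd (τ v))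
      (c := fun j => windowCoeff τ lo hi w j u) fun j hj => by
        have := hw2 j hj
        omega
    rw [ofAdd_toAdd] at hs
    rw [map_mul, map_mul, hv3, hw3, map_mul, mul_assoc, ← mul_assoc (windowShift N _), hs,
      ← mul_assoc, ← mul_assoc, windowBase_mul, mul_assoc]
    simp only [windowCoeff_mul, LinearMap.add_apply]

theorem WindowControlled.inv [NeZero N] {m κ : ℤ} {w : FreeGroup Y}
    (hw : WindowControlled τ u θ m κ w) (h : κ ≤ m) :
    WindowControlled τ u θ (m - κ) κ w⁻¹ := by
  obtain ⟨hw1, hw2, hw3⟩ := hw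
  refine ⟨by rwa [map_inv, toAdd_inv, abs_neg], fun j hj => ?_, ?_⟩
  · rw [windowCoeff_inv, LinearMap.neg_apply, neg_ne_zero] at hj
    have := hw2 _ hj
    have := abs_le.1 hw1
    omega
  · have hs := windowShift_mul_windowBase (N := N) (k := - Multiplicative.toAdd (τ w))
      (c := fun j => - windowCoeff τ lo hi w j u) fun j hj => by
        have := hw2 j (neg_ne_zero.1 hj)
        rw [abs_neg]
        omega
    rw [ofAdd_neg, ofAdd_toAdd, map_inv] at hs
    rw [map_inv, hw3, mul_inv_rev, windowBase_inv, hs, map_inv, map_inv]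
    simp only [windowCoeff_inv, LinearMap.neg_apply, sub_neg_eq_add]

/-- Every word is controlled once the generators have their sequences supported sufficiently far
away from the ends of `[0, N)`, uniformly in `N`. -/
theorem exists_windowControlled (τ : FreeGroup Y →* Multiplicative ℤ) (w : FreeGroup Y) :
    ∃ C : ℤ, 0 ≤ C ∧ ∀ (lo : ℤ) (N : ℕ) [NeZero N], C ≤ lo → ∀ u : Y × Finset.Ico lo (N - lo) → ℤ,
      WindowControlled τ u (FreeGroup.lift fun y =>
        windowBase N (fun j => windowCoeff τ lo (N - lo) (FreeGroup.of y) j u) *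
          windowShift N (τ (FreeGroup.of y))) (lo - C) C w := by
  have hof : ∀ y (lo : ℤ) (N : ℕ) [NeZero N] (u : Y × Finset.Ico lo (N - lo) → ℤ),
      WindowControlled τ u (FreeGroup.lift fun y =>
        windowBase N (fun j => windowCoeff τ lo (N - lo) (FreeGroup.of y) j u) *
          windowShift N (τ (FreeGroup.of y))) lo
          |Multiplicative.toAdd (τ (FreeGroup.of y))| (FreeGroup.of y) := by
    intro y lo N _ u
    refine ⟨le_rfl, fun j hj => ?_, by simp⟩
    rw [windowCoeff_of] at hj
    split_ifs at hj with h
    · exact Finset.mem_Ico.1 h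
    · exact absurd rfl hj
  induction w using FreeGroup.induction_on with
  | C1 =>
    refine ⟨0, le_rfl, fun lo N _ _ u => ⟨by simp, fun j hj => ?_, ?_⟩⟩
    · simp [windowCoeff_one] at hj
    · simp only [map_one, windowCoeff_one, mul_one, LinearMap.zero_apply, windowBase_zero]
  | of y =>
    refine ⟨|Multiplicative.toAdd (τ (FreeGroup.of y))|, abs_nonneg _, fun lo N _ _ u => ?_⟩
    obtain ⟨h1, h2, h3⟩ := hof y lo N u
    refine ⟨h1, fun j hj => ?_, h3⟩
    have := h2 j hj
    have := abs_nonneg (Multiplicative.toAdd (τ (FreeGroup.of y)))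
    omega
  | inv_of y _ => exact ⟨_, abs_nonneg _, fun lo N _ h u => (hof y lo N u).inv h⟩
  | mul v w hv hw =>
    obtain ⟨C, hC, hv⟩ := hv
    obtain ⟨C', hC', hw⟩ := hw
    refine ⟨C + C', by omega, fun lo N _ h u => ?_⟩
    exact (hv lo N (by omega) u).mul (hw lo N (by omega) u) (by omega) (by omega) (by omega)

end Window

/-- A group given by at least two more generators than relators is large. After an epimorphism `τ`
onto `ℤ` that kills the relators is chosen, a homomorphism to the wreath product of a free group by
`ℤ/N` is sought, under which an element `t` with `τ t = 1` goes to a shift, and the generators go,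
up to shifts, to unknown powers of a fixed element in the various coordinates. Killing the relators
then amounts to a homogeneous linear system, which is underdetermined for large `N`. -/
theorem largeModulo_normalClosure_range_of_card_add_two_le {Y ρ : Type*} [Fintype Y] [Fintype ρ]
    (r : ρ → FreeGroup Y) (h : Fintype.card ρ + 2 ≤ Fintype.card Y) :
    LargeModulo (Subgroup.normalClosure (Set.range r)) := by
  obtain ⟨τ, hτr, hτ⟩ := FreeGroup.exists_hom_int r (by omega)
  obtain ⟨t, ht⟩ := hτ (Multiplicative.ofAdd 1)
  let R : Option ρ → FreeGroup Y := fun o => o.elim t r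
  choose C hC0 hC using fun o => exists_windowControlled τ (R o)
  obtain ⟨lo, hlo⟩ : ∃ lo : ℕ, ∀ o, C o ≤ lo := by
    refine ⟨∑ o, (C o).toNat, fun o => ?_⟩
    have := Finset.single_le_sum (f := fun o => (C o).toNat) (fun _ _ => Nat.zero_le _)
      (Finset.mem_univ o)
    have := hC0 o
    omega
  -- There are `card Y * (N - 2 * lo)` unknowns and `(card ρ + 1) * N` equations.
  let N : ℕ := 2 * lo * (Fintype.card ρ + 2) + 1
  have : NeZero N := ⟨by simp [N]⟩
  have hcard : Fintype.card (Option ρ × Fin N) <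
      Fintype.card (Y × Finset.Ico (lo : ℤ) (N - lo)) := by
    have h1 : ((N : ℤ) - lo - lo).toNat = N - 2 * lo := by omega
    have h2 : 2 * lo ≤ N := by simp only [N]; nlinarith
    simp only [Fintype.card_prod, Fintype.card_option, Fintype.card_fin, Fintype.card_coe,
      Int.card_Ico, h1]
    have h3 : (Fintype.card ρ + 2) * (N - 2 * lo) ≤ Fintype.card Y * (N - 2 * lo) :=
      Nat.mul_le_mul_right _ h
    refine lt_of_lt_of_le ?_ h3
    zify [h2]
    have : (N : ℤ) = 2 * lo * (Fintype.card ρ + 2) + 1 := by simp [N]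
    nlinarith
  obtain ⟨u, hu0, hu⟩ := LinearMap.exists_ne_zero_apply_eq_zero_of_card_lt hcard
    (LinearMap.pi fun p => windowCoeff τ lo (N - lo) (R p.1) (p.2 : ℕ))
  set θ : FreeGroup Y →* FreeGroup Bool ≀ᵣ Multiplicative (ZMod N) := FreeGroup.lift fun y =>
    windowBase N (fun j => windowCoeff τ lo (N - lo) (FreeGroup.of y) j u) *
      windowShift N (τ (FreeGroup.of y)) with hθ
  have hR : ∀ o, θ (R o) = windowShift N (τ (R o)) := by
    intro o
    obtain ⟨-, h2, h3⟩ := hC o lo N (hlo o) u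
    have hz : ∀ j, windowCoeff τ lo (N - lo) (R o) j u = 0 := by
      intro j
      by_contra hj
      have h4 := h2 j hj
      have h5 := hlo o
      have h6 := congrFun hu (o, ⟨j.toNat, by omega⟩)
      simp only [LinearMap.pi_apply, Pi.zero_apply] at h6
      rw [Int.toNat_of_nonneg (by omega)] at h6
      exact hj h6
    rw [h3]
    simp only [hz, windowBase_zero, one_mul]
  have hθr : ∀ l, θ (r l) = 1 := fun l => by
    have := hR (some l)
    rwa [show R (some l) = r l from rfl, hτr, map_one] at this
  have hθt : ∀ k : ℤ, θ (t ^ k) = windowShift N (Multiplicative.ofAdd k) := fun k => by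
    have := hR none
    rw [show R none = t from rfl] at this
    rw [map_zpow, this, ht, ← map_zpow, ← ofAdd_zsmul]
    simp
  obtain ⟨⟨y, j, hj⟩, hyj⟩ := Function.ne_iff.1 hu0
  have hj' := Finset.mem_Ico.1 hj
  let q : Multiplicative (ZMod N) := Multiplicative.ofAdd (j : ZMod N)
  have hq : ((Multiplicative.toAdd q).val : ℤ) = j := by
    simp only [q, toAdd_ofAdd, ZMod.val_intCast]
    exact Int.emod_eq_of_lt (by omega) (by omega)
  -- On the kernel of the map to `ℤ/N`, every coordinate is a homomorphism.
  let L : Subgroup (FreeGroup Y) := (RegularWreathProduct.rightHom.comp θ).ker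
  have hL : ∀ x : L, (θ x).right = 1 := fun x => x.2
  let ψ : L →* FreeGroup Bool :=
    { toFun := fun x => (θ x).left q
      map_one' := by simp
      map_mul' := fun x x' => by simp [hL x] }
  have hx : θ (FreeGroup.of y * t ^ (- Multiplicative.toAdd (τ (FreeGroup.of y)))) =
      windowBase N (fun j => windowCoeff τ lo (N - lo) (FreeGroup.of y) j u) := by
    rw [map_mul, hθt, ofAdd_neg, ofAdd_toAdd, map_inv, hθ, FreeGroup.lift_apply_of,
      mul_inv_cancel_right]
  have htN := hθt N
  refine ⟨L, Subgroup.finiteIndex_ker _, ψ,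
    ⟨⟨t ^ (N : ℤ), ?_⟩,
      ⟨FreeGroup.of y * t ^ (- Multiplicative.toAdd (τ (FreeGroup.of y))), ?_⟩, ?_⟩, ?_⟩
  · change (θ _).right = 1
    rw [htN]
    simp [windowShift]
  · change (θ _).right = 1
    rw [hx]
    rfl
  · intro hcomm
    change Commute ((θ _).left q) ((θ _).left q) at hcomm
    rw [htN, hx] at hcomm
    simp only [windowShift, windowBase, MonoidHom.coe_mk, OneHom.coe_mk, toAdd_ofAdd, hq,
      windowCoeff_of, dif_pos hj] at hcomm
    have h1 : Commute (FreeGroup.of true ^ (N : ℤ)) (FreeGroup.of true ^ j) :=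
      Commute.zpow_zpow_self _ _ _
    have h2 := (h1.inv_right.mul_right hcomm).mul_right h1
    simp only [mul_assoc, inv_mul_cancel_left, inv_mul_cancel, mul_one, zpow_natCast] at h2
    exact FreeGroup.not_commute_pow_zpow (NeZero.ne N) hyj h2
  · have hle : Subgroup.normalClosure (Set.range r) ≤ θ.ker := by
      refine Subgroup.normalClosure_le_normal ?_
      rintro _ ⟨l, rfl⟩
      exact hθr l
    intro x hx
    have h1 : θ x = 1 := hle hx
    refine ⟨?_, ?_⟩
    · change (θ x).right = 1
      rw [h1]
      rfl
    · change (θ x).left q = 1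
      rw [h1]
      rfl

/-! ### Subgroups of finite index in free groups -/

/-- The lower bound in the Schreier index formula. A cocycle on the Schreier graph has
`card X * K.index` free parameters, and is determined by its values on a basis of `K` and on
representatives of the nontrivial cosets. -/
theorem FreeGroupBasis.card_mul_index_add_one_le {X Y : Type*} [Fintype X] [Fintype Y]
    {K : Subgroup (FreeGroup X)} [K.Normal] [K.FiniteIndex] (b : FreeGroupBasis Y K) :
    Fintype.card X * K.index + 1 ≤ Fintype.card Y + K.index := by
  classical
  let Q := FreeGroup X ⧸ K
  let _ : Fintype Q := Fintype.ofFinite Q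
  have hQ : Fintype.card Q = K.index := by rw [Subgroup.index, Nat.card_eq_fintype_card]
  -- The universal crossed homomorphism into the module of functions on `Q`.
  let θ : FreeGroup X →* Multiplicative ((X × Q → ℤ) →ₗ[ℤ] ℤ) ≀ᵣ Q := FreeGroup.lift fun x =>
    ⟨fun q => Multiplicative.ofAdd (LinearMap.proj (x, q)), QuotientGroup.mk' K (FreeGroup.of x)⟩
  have hright : ∀ w, (θ w).right = QuotientGroup.mk' K w := by
    have : RegularWreathProduct.rightHom.comp θ = QuotientGroup.mk' K := by
      ext x
      simp only [θ, MonoidHom.comp_apply, FreeGroup.lift_apply_of]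
      rfl
    exact DFunLike.congr_fun this
  let δ : FreeGroup X → ((X × Q → ℤ) →ₗ[ℤ] ℤ) := fun w => Multiplicative.toAdd ((θ w).left 1)
  have hδ : ∀ v w, δ (v * w) =
      δ v + Multiplicative.toAdd ((θ w).left (QuotientGroup.mk' K v)⁻¹) := by
    intro v w
    simp only [δ, map_mul, RegularWreathProduct.mul_left, Pi.mul_apply, toAdd_mul, hright, mul_one]
  have hδK : ∀ k ∈ K, ∀ w, δ (k * w) = δ k + δ w := by
    intro k hk w
    rw [hδ, show QuotientGroup.mk' K k = 1 from (QuotientGroup.eq_one_iff k).2 hk, inv_one]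
  let Φ : (X × Q → ℤ) →ₗ[ℤ] (Y ⊕ {q : Q // q ≠ 1} → ℤ) :=
    LinearMap.pi (Sum.elim (fun y => δ (b y)) (fun q => δ q.1.out))
  have hcard : Fintype.card (X × Q) ≤ Fintype.card (Y ⊕ {q : Q // q ≠ 1}) := by
    by_contra! hlt
    obtain ⟨u, hu0, hu⟩ := LinearMap.exists_ne_zero_apply_eq_zero_of_card_lt hlt Φ
    have h1 : ∀ k ∈ K, δ k u = 0 := by
      let f : K →* Multiplicative ℤ :=
        { toFun := fun k => Multiplicative.ofAdd (δ k u)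
          map_one' := by simp [δ]
          map_mul' := fun k k' => by
            rw [Subgroup.coe_mul, hδK k k.2, LinearMap.add_apply, ofAdd_add] }
      have hf : f = 1 := b.ext_hom _ _ fun y => congrFun hu (Sum.inl y)
      exact fun k hk => DFunLike.congr_fun hf ⟨k, hk⟩
    have h2 : ∀ a, δ a u = 0 := by
      intro a
      by_cases ha : (a : Q) = 1
      · exact h1 a ((QuotientGroup.eq_one_iff a).1 ha)
      · have hk : a * (Quotient.out (a : Q))⁻¹ ∈ K := by
          rw [← QuotientGroup.eq_one_iff, QuotientGroup.mk_mul, QuotientGroup.mk_inv,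
            QuotientGroup.out_eq', mul_inv_cancel]
        rw [← inv_mul_cancel_right a (Quotient.out (a : Q)), hδK _ hk, LinearMap.add_apply,
          h1 _ hk, zero_add]
        exact congrFun hu (Sum.inr ⟨(a : Q), ha⟩)
    refine hu0 (funext fun ⟨x, q⟩ => ?_)
    obtain ⟨a, ha⟩ := QuotientGroup.mk'_surjective K q⁻¹
    have hq : (QuotientGroup.mk' K a)⁻¹ = q := inv_eq_iff_eq_inv.2 ha
    have h3 := congrArg (fun l => l u) (hδ a (FreeGroup.of x))
    simp only [LinearMap.add_apply, h2, zero_add, hq] at h3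
    simpa [θ] using h3.symm
  have h1 : Fintype.card {q : Q // q ≠ 1} = Fintype.card Q - 1 := by
    rw [Fintype.card_subtype_compl, Fintype.card_subtype_eq]
  have h2 : 0 < Fintype.card Q := Fintype.card_pos
  rw [Fintype.card_prod, Fintype.card_sum, h1] at hcard
  rw [← hQ]
  omega

theorem Subgroup.largeModulo_normalClosure_of_card_lt_index {K : Subgroup (FreeGroup Bool)}
    [K.Normal] [K.FiniteIndex] {ρ : Type*} [Fintype ρ] (r : ρ → K)
    (h : Fintype.card ρ < K.index) : LargeModulo (Subgroup.normalClosure (Set.range r)) := by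
  classical
  let b := IsFreeGroup.basis K
  obtain ⟨s, hs⟩ : ∃ s : Finset (IsFreeGroup.Generators K), s.card = K.index + 1 := by
    rcases finite_or_infinite (IsFreeGroup.Generators K) with hfin | hinf
    · have := Fintype.ofFinite (IsFreeGroup.Generators K)
      have h1 := b.card_mul_index_add_one_le
      rw [Fintype.card_bool] at h1
      obtain ⟨s, -, hs⟩ := Finset.exists_subset_card_eq
        (s := (Finset.univ : Finset (IsFreeGroup.Generators K))) (n := K.index + 1)
        (by rw [Finset.card_univ]; omega)
      exact ⟨s, hs⟩
    · exact Infinite.exists_subset_card_eq _ _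
  -- Kill the basis elements outside `s`.
  let π : FreeGroup (IsFreeGroup.Generators K) →* FreeGroup s :=
    FreeGroup.lift fun y => if hy : y ∈ s then FreeGroup.of ⟨y, hy⟩ else 1
  have hπ : Function.Surjective π := by
    have : π.comp (FreeGroup.map Subtype.val) = MonoidHom.id _ := by
      ext y
      simp [π]
    exact fun w => ⟨_, DFunLike.congr_fun this w⟩
  let φ : K →* FreeGroup s := π.comp b.repr.toMonoidHom
  have hφ : Function.Surjective φ := hπ.comp b.repr.surjective
  refine (largeModulo_normalClosure_range_of_card_add_two_le (φ ∘ r) ?_).comap hφ ?_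
  · rw [Fintype.card_coe, hs]
    omega
  · refine Subgroup.normalClosure_le_normal ?_
    rintro _ ⟨l, rfl⟩
    exact Subgroup.subset_normalClosure ⟨l, rfl⟩

/-- If every element of `J i` agrees modulo `K` with an element centralizing `x i`, then the
conjugates of `x i` by representatives of the cosets of `J i` suffice to generate, as a normal
subgroup of `K`, the normal closure of all the `x i` in `G`. -/
theorem Subgroup.normalClosure_range_le_map {G ι : Type*} [Group G] {K : Subgroup G} [hK : K.Normal]
    {x : ι → G} (hx : ∀ i, x i ∈ K) (J : ι → Subgroup G)
    (hJ : ∀ i, ∀ h ∈ J i, ∃ k ∈ K, Commute (h * k) (x i)) :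
    Subgroup.normalClosure (Set.range x) ≤ (Subgroup.normalClosure (Set.range
      fun p : Σ i, G ⧸ J i => (⟨p.2.out * x p.1 * p.2.out⁻¹, hK.conj_mem _ (hx p.1) _⟩ : K))).map
        K.subtype := by
  rw [Subgroup.normalClosure, Subgroup.closure_le]
  intro y hy
  obtain ⟨_, ⟨i, rfl⟩, hconj⟩ := Group.mem_conjugatesOfSet_iff.1 hy
  obtain ⟨a, rfl⟩ := isConj_iff.1 hconj
  obtain ⟨⟨h, hh⟩, hout⟩ := QuotientGroup.mk_out_eq_mul (J i) a
  obtain ⟨k, hk, hcomm⟩ := hJ i h hh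
  set c := Quotient.out (a : G ⧸ J i) with hc
  have hmem : (⟨c * x i * c⁻¹, hK.conj_mem _ (hx i) _⟩ : K) ∈ Subgroup.normalClosure (Set.range
      fun p : Σ i, G ⧸ J i => (⟨p.2.out * x p.1 * p.2.out⁻¹, hK.conj_mem _ (hx p.1) _⟩ : K)) :=
    Subgroup.subset_normalClosure ⟨⟨i, (a : G ⧸ J i)⟩, rfl⟩
  refine ⟨_, Subgroup.normalClosure_normal.conj_mem _ hmem ⟨c * k * c⁻¹, hK.conj_mem _ hk _⟩, ?_⟩
  have ha : a = c * k * (h * k)⁻¹ := by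
    rw [hout]
    group
  have hz : (h * k)⁻¹ * x i * (h * k) = x i := by
    rw [mul_assoc, ← hcomm.eq, inv_mul_cancel_left]
  calc (c * k * c⁻¹) * (c * x i * c⁻¹) * (c * k * c⁻¹)⁻¹ = c * k * x i * (c * k)⁻¹ := by group
    _ = c * k * ((h * k)⁻¹ * x i * (h * k)) * (c * k)⁻¹ := by rw [hz]
    _ = a * x i * a⁻¹ := by rw [ha]; group

/-! ### Power relators -/

theorem FreeGroup.exists_largeModulo_normalClosure_pow_of_ne_one {ι : Type*} [Fintype ι]
    (f : ι → FreeGroup Bool) (hf : ∀ i, f i ≠ 1) : ∃ n₀ : ℕ, ∀ n > n₀,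
      LargeModulo (Subgroup.normalClosure (Set.range fun i => f i ^ n)) := by
  set m := Fintype.card ι with hm
  have hf' : ∀ p : ι × Fin m, f p.1 ^ ((p.2 : ℕ) + 1) ≠ 1 := fun p => by
    rw [Ne, pow_eq_one_iff_left (by omega)]
    exact hf p.1
  choose n₀ hn₀ using fun p => FreeGroup.exists_finiteIndex_pow_mem _ (hf' p)
  refine ⟨∑ p, n₀ p, fun n hn => ?_⟩
  choose K' hK'n hK'f hK' hK'' using fun p => hn₀ p n
    ((Finset.single_le_sum (fun _ _ => Nat.zero_le _) (Finset.mem_univ p)).trans_lt hn)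
  let K : Subgroup (FreeGroup Bool) := ⨅ p, K' p
  have : K.Normal := Subgroup.normal_iInf_normal hK'n
  have : K.FiniteIndex := Subgroup.finiteIndex_iInf hK'f
  have hKn : ∀ y, y ^ n ∈ K := fun y => Subgroup.mem_iInf.2 fun p => hK' p y
  -- Modulo `K`, each `f i` has order greater than the number of relators.
  have hord : ∀ i, m + 1 ≤ orderOf (QuotientGroup.mk' K (f i)) := by
    intro i
    by_contra! hlt
    have hpos := orderOf_pos (QuotientGroup.mk' K (f i))
    have h1 := pow_orderOf_eq_one (QuotientGroup.mk' K (f i))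
    rw [← map_pow] at h1
    have h2 := Subgroup.mem_iInf.1 ((QuotientGroup.eq_one_iff _).1 h1)
      (i, ⟨orderOf (QuotientGroup.mk' K (f i)) - 1, by omega⟩)
    refine hK'' (i, ⟨orderOf (QuotientGroup.mk' K (f i)) - 1, by omega⟩) ?_
    simpa only [Nat.sub_add_cancel hpos] using h2
  let J : ι → Subgroup (FreeGroup Bool) := fun i =>
    (Subgroup.zpowers (QuotientGroup.mk' K (f i))).comap (QuotientGroup.mk' K)
  have hJ : ∀ i, (m + 1) * (J i).index ≤ K.index := by
    intro i
    rw [Subgroup.index_comap_of_surjective _ (QuotientGroup.mk'_surjective K)]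
    refine (Nat.mul_le_mul_right _ (hord i)).trans_eq ?_
    rw [← Nat.card_zpowers, Subgroup.card_mul_index]
    rfl
  have hJf : ∀ i, (J i).FiniteIndex := fun i => ⟨by
    rw [Subgroup.index_comap_of_surjective _ (QuotientGroup.mk'_surjective K)]
    exact Subgroup.FiniteIndex.index_ne_zero⟩
  let _ : ∀ i, Fintype (FreeGroup Bool ⧸ J i) := fun i => Fintype.ofFinite _
  have hle := Subgroup.normalClosure_range_le_map (K := K) (x := fun i => f i ^ n)
    (fun i => hKn (f i)) J fun i h hh => by
      obtain ⟨s, hs⟩ := Subgroup.mem_zpowers_iff.1 (Subgroup.mem_comap.1 hh)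
      refine ⟨h⁻¹ * f i ^ s, ?_, ?_⟩
      · rw [← QuotientGroup.eq_one_iff, QuotientGroup.mk_mul, QuotientGroup.mk_inv]
        rw [← map_zpow] at hs
        exact inv_mul_eq_one.2 hs.symm
      · rw [mul_inv_cancel_left]
        exact ((Commute.refl (f i)).zpow_left s).pow_right n
  refine LargeModulo.of_subgroup (Subgroup.largeModulo_normalClosure_of_card_lt_index _ ?_) hle
  have hsum : (m + 1) * ∑ i, (J i).index ≤ m * K.index := by
    rw [Finset.mul_sum, hm, ← smul_eq_mul (Fintype.card ι), ← Finset.card_univ]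
    exact Finset.sum_le_card_nsmul _ _ _ fun i _ => hJ i
  have hKpos : 0 < K.index := Nat.pos_of_ne_zero Subgroup.FiniteIndex.index_ne_zero
  have hcard : Fintype.card (Σ i, FreeGroup Bool ⧸ J i) = ∑ i, (J i).index := by
    rw [Fintype.card_sigma]
    exact Finset.sum_congr rfl fun i _ => Nat.card_eq_fintype_card.symm
  rw [hcard]
  by_contra! hcon
  have := Nat.mul_le_mul_left (m + 1) hcon
  nlinarith

/-- In a free group of rank two, all sufficiently large powers of finitely many elements can be
killed so that the quotient remains large. -/
theorem FreeGroup.exists_largeModulo_normalClosure_pow {ι : Type*} [Finite ι]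
    (f : ι → FreeGroup Bool) : ∃ n₀ : ℕ, ∀ n > n₀,
      LargeModulo (Subgroup.normalClosure (Set.range fun i => f i ^ n)) := by
  classical
  have := Fintype.ofFinite ι
  obtain ⟨n₀, h⟩ := FreeGroup.exists_largeModulo_normalClosure_pow_of_ne_one
    (fun i : {i // f i ≠ 1} => f i) fun i => i.2
  refine ⟨n₀, fun n hn => (h n hn).comap (φ := MonoidHom.id _) Function.surjective_id ?_⟩
  refine Subgroup.normalClosure_le_normal ?_
  rintro _ ⟨i, rfl⟩
  by_cases hi : f i = 1
  · simp only [hi, one_pow]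
    exact one_mem _
  · exact Subgroup.subset_normalClosure ⟨⟨i, hi⟩, rfl⟩

theorem theorem1 {G : Type u} [Group G] (H : Subgroup G) (hnormal : H.Normal)
    (hindex : H.FiniteIndex) (hfree : MapsOntoNoncyclicFree H)
    {k : ℕ} (g : Fin k → G) (hg : ∀ i, g i ∈ H) :
    {n : ℕ | ¬ IsLargeGroup
      (G ⧸ Subgroup.normalClosure (Set.range fun i => g i ^ n))}.Finite := by
  obtain ⟨F, _, _, hF, φ, hφ⟩ := hfree
  obtain ⟨π, hπ⟩ := IsFreeGroup.exists_surjective_freeGroup_bool F hF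
  let f : (Σ _ : Fin k, G ⧸ H) → FreeGroup Bool := fun p =>
    π (φ ⟨p.2.out * g p.1 * p.2.out⁻¹, hnormal.conj_mem _ (hg p.1) _⟩)
  obtain ⟨n₀, hn₀⟩ := FreeGroup.exists_largeModulo_normalClosure_pow f
  refine (Set.finite_Iic n₀).subset fun n hn => ?_
  by_contra hlt
  refine hn (LargeModulo.isLargeGroup ?_)
  have hle := Subgroup.normalClosure_range_le_map (K := H) (x := fun i => g i ^ n)
    (fun i => pow_mem (hg i) n) (fun _ => H)
    fun i h hh => ⟨h⁻¹, inv_mem hh, by rw [mul_inv_cancel]; exact Commute.one_left _⟩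
  refine LargeModulo.of_subgroup ?_ hle
  refine (hn₀ n (not_le.1 hlt)).comap (φ := π.comp φ) (hπ.comp hφ) ?_
  refine Subgroup.normalClosure_le_normal ?_
  rintro _ ⟨p, rfl⟩
  refine Subgroup.subset_normalClosure ⟨p, ?_⟩
  change π (φ _) ^ n = π (φ _)
  rw [← map_pow, ← map_pow]
  exact congrArg (fun y => π (φ y)) (Subtype.ext conj_pow)
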